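/- For $n\ge 1$ and an $n$-tuple $(a_1,\dots,a_n)$ of non-negative integers put $N(a_1,\dots,a_n)=\sum_{i=1}^n(a_i^2-1)-\left(\prod_{i=1}^n a_i-1\right)$; thus $N(a,b,c)=a^2+b^2+c^2-abc-2$. An $n$-tuple $(b_1,\dots,b_n)$ of non-negative integers is a castling transform of $(a_1,\dots,a_n)$ if $(b_1,\dots,b_n)=\left(a_{\sigma(1)},\dots,a_{\sigma(n-1)},\prod_{i=1}^{n-1}a_{\sigma(i)}-a_{\sigma(n)}\right)$ for some permutation $\sigma\in S_n$. Castling equivalence is the equivalence relation on $n$-tuples of non-negative integers generated by castling transformations. A triple $(a,b,c)$ is called prehomogeneous if the natural action of $GL_a(\mathbb{C})\times GL_b(\mathbb{C})\times GL_c(\mathbb{C})$ on $\mathbb{C}^a\otimes\mathbb{C}^b\otimes\mathbb{C}^c$ has an orbit that is dense in the Zariski topology. Let $a,b,c$ be positive integers with $N(a,b,c)=2$. Then there is a unique positive integer $k$ such that $(a,b,c)$ is castling-equivalent to $(2,k,k)$. Moreover, for this $k$, the triple $(a,b,c)$ is prehomogeneous if and only if $k\le 3$. -/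

import Mathlib

open scoped TensorProduct

/-- The invariant `N(a₁, …, aₙ) = ∑ (aᵢ² - 1) - (∏ aᵢ - 1)` of an `n`-tuple. -/
def tensorN {n : ℕ} (a : Fin n → ℕ) : ℤ :=
  ∑ i, ((a i : ℤ) ^ 2 - 1) - ((∏ i, (a i : ℤ)) - 1)

/-- `b` is a castling transform of `a`: for some permutation `σ`,
`b = (a_{σ(1)}, …, a_{σ(n-1)}, ∏_{i<n} a_{σ(i)} - a_{σ(n)})`, where the last entry must be
non-negative (it is written as an addition, so no subtraction is truncated). Tuples have
length `n + 1` here. -/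
def IsCastlingTransform {n : ℕ} (a b : Fin (n + 1) → ℕ) : Prop :=
  ∃ σ : Equiv.Perm (Fin (n + 1)),
    (∀ i : Fin n, b i.castSucc = a (σ i.castSucc)) ∧
      b (Fin.last n) + a (σ (Fin.last n)) = ∏ i : Fin n, a (σ i.castSucc)

/-- Castling equivalence: the equivalence relation generated by castling transformations. -/
def CastlingEquiv {n : ℕ} (a b : Fin (n + 1) → ℕ) : Prop :=
  Relation.EqvGen IsCastlingTransform a b

/-- The algebra of polynomial functions on a complex vector space: the subalgebra of all
functions that is generated by the linear forms. -/
def polyFunctions (V : Type*) [AddCommMonoid V] [Module ℂ V] : Subalgebra ℂ (V → ℂ) :=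
  Algebra.adjoin ℂ (Set.range fun φ : Module.Dual ℂ V => (φ : V → ℂ))

/-- The Zariski topology on a complex vector space: the closed sets are the common zero sets of
families of polynomial functions. -/
@[reducible] def zariskiTopology (V : Type*) [AddCommMonoid V] [Module ℂ V] : TopologicalSpace V :=
  TopologicalSpace.ofClosed
    {Z | ∃ S : Set (V → ℂ), (∀ f ∈ S, f ∈ polyFunctions V) ∧ Z = {v | ∀ f ∈ S, f v = 0}}
    ⟨{1}, by
      rintro f rfl
      exact one_mem _, by
      ext v
      simp⟩
    (by
      intro A hA
      refine ⟨{f | f ∈ polyFunctions V ∧ ∃ Z ∈ A, ∀ v ∈ Z, f v = 0}, fun f hf => hf.1, ?_⟩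
      ext v
      constructor
      · rintro hv f ⟨-, Z, hZ, hf⟩
        exact hf v (hv Z hZ)
      · intro hv Z hZ
        obtain ⟨S, hS, rfl⟩ := hA hZ
        intro f hf
        exact hv f ⟨hS f hf, _, hZ, fun w hw => hw f hf⟩)
    (by
      rintro _ ⟨S, hS, rfl⟩ _ ⟨T, hT, rfl⟩
      refine ⟨{h | ∃ f ∈ S, ∃ g ∈ T, h = f * g}, ?_, ?_⟩
      · rintro _ ⟨f, hf, g, hg, rfl⟩
        exact mul_mem (hS f hf) (hT g hg)
      · ext v
        constructor
        · rintro (hv | hv) _ ⟨f, hf, g, hg, rfl⟩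
          · simp [hv f hf]
          · simp [hv g hg]
        · intro hv
          by_contra hcon
          rw [Set.mem_union, not_or] at hcon
          obtain ⟨h1, h2⟩ := hcon
          simp only [Set.mem_ofPred_eq, not_forall] at h1 h2
          obtain ⟨f, hf, hfv⟩ := h1
          obtain ⟨g, hg, hgv⟩ := h2
          have := hv _ ⟨f, hf, g, hg, rfl⟩
          simp [hfv, hgv] at this)

/-- A representation is prehomogeneous if it has an orbit that is dense for the Zariski
topology. -/
def IsPrehomogeneous {G V : Type*} [Group G] [AddCommMonoid V] [Module ℂ V]
    (ρ : Representation ℂ G V) : Prop :=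
  ∃ v : V, @Dense V (zariskiTopology V) (Set.range fun g : G => ρ g v)

/-- The natural representation of `GL_a(ℂ) × GL_b(ℂ) × GL_c(ℂ)` on `ℂ^a ⊗ ℂ^b ⊗ ℂ^c`. -/
noncomputable def tensorRep (a b c : ℕ) :
    Representation ℂ
      (Matrix.GeneralLinearGroup (Fin a) ℂ × Matrix.GeneralLinearGroup (Fin b) ℂ ×
        Matrix.GeneralLinearGroup (Fin c) ℂ)
      ((Fin a → ℂ) ⊗[ℂ] (Fin b → ℂ) ⊗[ℂ] (Fin c → ℂ)) where
  toFun g :=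
    TensorProduct.map
      (TensorProduct.map (Matrix.toLin' (g.1 : Matrix (Fin a) (Fin a) ℂ))
        (Matrix.toLin' (g.2.1 : Matrix (Fin b) (Fin b) ℂ)))
      (Matrix.toLin' (g.2.2 : Matrix (Fin c) (Fin c) ℂ))
  map_one' := by simp [Module.End.one_eq_id]
  map_mul' g h := by simp [Matrix.toLin'_mul, TensorProduct.map_comp, Module.End.mul_eq_comp]

/-! ### Polynomial functions and Zariski density -/

section PolynomialFunctions

variable {V W : Type*} [AddCommMonoid V] [Module ℂ V] [AddCommMonoid W] [Module ℂ W]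

/-! Existence of `k` is a descent: sort the triple as `a ≤ b ≤ c`. If `a ≥ 3`, then `ab - c` is
positive and smaller than `c`, so castling lowers the sum; `a = 1` forces `(1, 1, 2)` and `a = 2`
forces `b = c` (`exists_castlingEquiv_two`).

Uniqueness comes from an invariant: when `N = 2`, castling preserves divisibility of all `aᵢ² - 4`
by a fixed `g` (`TripleDvd`). Since `(2, k, k)` has the property exactly when `g ∣ k² - 4`,
equivalent `(2, k, k)` and `(2, l, l)` have `k² - 4` and `l² - 4` dividing each other.

Prehomogeneity is castling invariant: a general tensor is a `c`-dimensional subspace of `ℂ^a ⊗ ℂ^b`,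
and orthogonal complements exchange dimensions `c` and `ab - c`
(`exists_isPolyDense_matrixOrbit_castling`). This leaves pencils of `k × k` matrices. For `k ≥ 4`,
the determinant of the pencil at five points takes arbitrary values, but on one orbit these values
depend polynomially on four parameters, hence satisfy a nontrivial relation
(`not_isPolyDense_pencilOrbit`). For `k ≤ 3`, the orbit map of the pencil `(1, D)`, with `D`
diagonal with distinct entries, is a submersion at the identity, so the orbit contains an open set
(`exists_isPolyDense_pencilOrbit`). -/

theorem dual_mem_polyFunctions (φ : Module.Dual ℂ V) : (φ : V → ℂ) ∈ polyFunctions V :=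
  Algebra.subset_adjoin ⟨φ, rfl⟩

theorem const_mem_polyFunctions (c : ℂ) : (fun _ : V => c) ∈ polyFunctions V :=
  (polyFunctions V).algebraMap_mem c

/-- A set is polynomially dense if every polynomial function vanishing on it is zero. -/
def IsPolyDense (S : Set V) : Prop :=
  ∀ f ∈ polyFunctions V, (∀ v ∈ S, f v = 0) → ∀ v, f v = 0

theorem dense_zariski_iff (S : Set V) : @Dense V (zariskiTopology V) S ↔ IsPolyDense S := by
  let _ := zariskiTopology V
  have hclosed : ∀ Z : Set V, IsClosed Z ↔
      ∃ T : Set (V → ℂ), (∀ f ∈ T, f ∈ polyFunctions V) ∧ Z = {v | ∀ f ∈ T, f v = 0} := by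
    intro Z
    rw [← isOpen_compl_iff]
    change Zᶜᶜ ∈ _ ↔ _
    rw [compl_compl]
    rfl
  constructor
  · intro hS f hf hfS v
    have hZ : IsClosed {v | f v = 0} :=
      (hclosed _).2 ⟨{f}, by simpa using hf, by simp⟩
    have := hZ.closure_subset_iff.2 (show S ⊆ {v | f v = 0} from hfS)
    exact this (hS v)
  · intro hS v
    obtain ⟨T, hT, hZ⟩ := (hclosed (closure S)).1 isClosed_closure
    rw [hZ]
    intro f hf
    refine hS f (hT f hf) (fun w hw => ?_) v
    have := subset_closure hw
    rw [hZ] at this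
    exact this f hf

/-- A map is polynomial if its composition with every linear form is a polynomial function. -/
def IsPolyMap (φ : V → W) : Prop :=
  ∀ l : Module.Dual ℂ W, (fun v => l (φ v)) ∈ polyFunctions V

theorem IsPolyMap.comp_mem {φ : V → W} (hφ : IsPolyMap φ) {f : W → ℂ}
    (hf : f ∈ polyFunctions W) : (fun v => f (φ v)) ∈ polyFunctions V := by
  induction hf using Algebra.adjoin_induction with
  | mem f hf =>
    obtain ⟨l, rfl⟩ := hf
    exact hφ l
  | algebraMap r => exact const_mem_polyFunctions r
  | add f g _ _ hf hg => exact add_mem hf hg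
  | mul f g _ _ hf hg => exact mul_mem hf hg

theorem LinearMap.isPolyMap (φ : V →ₗ[ℂ] W) : IsPolyMap φ := fun l =>
  dual_mem_polyFunctions (l.comp φ)

/-- Restriction to lines reduces the identity principles below to one variable, without coordinates
on `V`. -/
theorem exists_polynomial_on_line {f : V → ℂ} (hf : f ∈ polyFunctions V) (v w : V) :
    ∃ p : Polynomial ℂ, ∀ t : ℂ, p.eval t = f (v + t • w) := by
  induction hf using Algebra.adjoin_induction with
  | mem f hf =>
    obtain ⟨l, rfl⟩ := hf
    exact ⟨.C (l v) + .X * .C (l w), fun t => by simp; ring⟩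
  | algebraMap r => exact ⟨.C r, fun t => by simp⟩
  | add f g _ _ hf hg =>
    obtain ⟨p, hp⟩ := hf
    obtain ⟨q, hq⟩ := hg
    exact ⟨p + q, fun t => by simp [hp, hq]⟩
  | mul f g _ _ hf hg =>
    obtain ⟨p, hp⟩ := hf
    obtain ⟨q, hq⟩ := hg
    exact ⟨p * q, fun t => by simp [hp, hq]⟩

theorem eq_zero_of_mul_eq_zero_polyFunctions {V : Type*} [AddCommGroup V] [Module ℂ V] {f g : V → ℂ} (hf : f ∈ polyFunctions V)
    (hg : g ∈ polyFunctions V) (h : ∀ v, f v ≠ 0 → g v = 0) (hne : ∃ v, f v ≠ 0) (w : V) :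
    g w = 0 := by
  obtain ⟨v, hv⟩ := hne
  obtain ⟨p, hp⟩ := exists_polynomial_on_line hf v (w - v)
  obtain ⟨q, hq⟩ := exists_polynomial_on_line hg v (w - v)
  have hpq : p * q = 0 := by
    apply Polynomial.funext
    intro t
    by_cases ht : p.eval t = 0
    · simp [ht]
    · have := h _ (hp t ▸ ht)
      simp [hq, this]
  rcases mul_eq_zero.1 hpq with h0 | h0
  · exact absurd (by simpa [h0] using (hp 0).symm) hv
  · simpa [h0] using (hq 1).symm

theorem eq_zero_of_eventually_line {V : Type*} [AddCommGroup V] [Module ℂ V] {f : V → ℂ} (hf : f ∈ polyFunctions V) (v : V)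
    (h : ∀ w : V, ∀ᶠ t : ℂ in nhds 0, f (v + t • w) = 0) (w : V) : f w = 0 := by
  obtain ⟨p, hp⟩ := exists_polynomial_on_line hf v (w - v)
  have hp0 : p = 0 := by
    apply Polynomial.eq_zero_of_infinite_isRoot
    apply infinite_of_mem_nhds (0 : ℂ)
    filter_upwards [h (w - v)] with t ht
    simp [Polynomial.IsRoot, hp, ht]
  simpa [hp0] using (hp 1).symm

theorem isPolyMap_matrix {m n : Type*} [Fintype m] [Fintype n] [DecidableEq m] [DecidableEq n] {φ : V → Matrix m n ℂ}
    (h : ∀ i j, (fun v => φ v i j) ∈ polyFunctions V) : IsPolyMap φ := by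
  intro k
  have : (fun v => k (φ v)) = ∑ i, ∑ j, k (Matrix.single i j 1) • fun v => φ v i j := by
    funext v
    conv_lhs => rw [Matrix.matrix_eq_sum_single (φ v)]
    simp only [map_sum, Finset.sum_apply, Pi.smul_apply, smul_eq_mul]
    refine Finset.sum_congr rfl fun i _ => Finset.sum_congr rfl fun j _ => ?_
    rw [← mul_one (φ v i j), ← smul_eq_mul, ← Matrix.smul_single, map_smul]
    simp [mul_comm]
  rw [this]
  exact sum_mem fun i _ => sum_mem fun j _ => Subalgebra.smul_mem _ (h i j) _

theorem entry_mem_polyFunctions {m n : Type*} (i : m) (j : n) :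
    (fun X : Matrix m n ℂ => X i j) ∈ polyFunctions (Matrix m n ℂ) :=
  dual_mem_polyFunctions (Matrix.entryLinearMap ℂ ℂ i j)

theorem det_mem_polyFunctions {m : Type*} [Fintype m] [DecidableEq m] {φ : V → Matrix m m ℂ}
    (h : ∀ i j, (fun v => φ v i j) ∈ polyFunctions V) :
    (fun v => (φ v).det) ∈ polyFunctions V := by
  have : (fun v => (φ v).det) =
      ∑ σ : Equiv.Perm m, ((σ.sign : ℤ) : ℂ) • ∏ i, fun v => φ v (σ i) i := by
    funext v
    simp [Matrix.det_apply', Finset.sum_apply, Finset.prod_apply]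
  rw [this]
  exact sum_mem fun σ _ => Subalgebra.smul_mem _ (prod_mem fun i _ => h _ _) _

theorem mul_entry_mem_polyFunctions {m n l : Type*} [Fintype n] {φ : V → Matrix m n ℂ} {ψ : V → Matrix n l ℂ}
    (hφ : ∀ i j, (fun v => φ v i j) ∈ polyFunctions V)
    (hψ : ∀ i j, (fun v => ψ v i j) ∈ polyFunctions V) (i : m) (j : l) :
    (fun v => (φ v * ψ v) i j) ∈ polyFunctions V := by
  have : (fun v => (φ v * ψ v) i j) = ∑ k, (fun v => φ v i k) * fun v => ψ v k j := by
    funext v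
    simp [Matrix.mul_apply, Finset.sum_apply]
  rw [this]
  exact sum_mem fun k _ => mul_mem (hφ _ _) (hψ _ _)

theorem adjugate_entry_mem_polyFunctions {m : Type*} [Fintype m] [DecidableEq m] {φ : V → Matrix m m ℂ}
    (h : ∀ i j, (fun v => φ v i j) ∈ polyFunctions V) (i j : m) :
    (fun v => (φ v).adjugate i j) ∈ polyFunctions V := by
  simp only [Matrix.adjugate_apply]
  refine det_mem_polyFunctions fun p q => ?_
  by_cases hp : p = j
  · simp only [Matrix.updateRow_apply, hp, if_true]
    exact const_mem_polyFunctions _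
  · simp only [Matrix.updateRow_apply, hp, if_false]
    exact h p q

end PolynomialFunctions

/-! ### Transport along linear isomorphisms; permuting tensor factors -/

section Transport

variable {G H V W : Type*} [Group G] [Group H] [AddCommMonoid V] [Module ℂ V]
  [AddCommMonoid W] [Module ℂ W]

theorem isPrehomogeneous_iff (ρ : Representation ℂ G V) :
    IsPrehomogeneous ρ ↔ ∃ v, IsPolyDense (Set.range fun g => ρ g v) :=
  exists_congr fun _ => dense_zariski_iff _

theorem IsPolyDense.image_equiv {S : Set V} (hS : IsPolyDense S) (e : V ≃ₗ[ℂ] W) {T : Set W}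
    (hT : ∀ v ∈ S, e v ∈ T) : IsPolyDense T := by
  intro f hf hfT w
  have := hS (fun v => f (e v)) ((LinearMap.isPolyMap e.toLinearMap).comp_mem hf)
    (fun v hv => hfT _ (hT v hv)) (e.symm w)
  simpa using this

theorem IsPrehomogeneous.of_equiv {ρ : Representation ℂ G V} {ρ' : Representation ℂ H W}
    (e : V ≃ₗ[ℂ] W) (h : ∀ g, ∃ g', ∀ v, e (ρ g v) = ρ' g' (e v))
    (hρ : IsPrehomogeneous ρ) : IsPrehomogeneous ρ' := by
  rw [isPrehomogeneous_iff] at hρ ⊢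
  obtain ⟨v, hv⟩ := hρ
  refine ⟨e v, hv.image_equiv e ?_⟩
  rintro _ ⟨g, rfl⟩
  obtain ⟨g', hg'⟩ := h g
  exact ⟨g', (hg' v).symm⟩

theorem tensorRep_tmul {a b c : ℕ}
    (g : Matrix.GeneralLinearGroup (Fin a) ℂ × Matrix.GeneralLinearGroup (Fin b) ℂ ×
        Matrix.GeneralLinearGroup (Fin c) ℂ) (x : Fin a → ℂ) (y : Fin b → ℂ) (z : Fin c → ℂ) :
    tensorRep a b c g ((x ⊗ₜ y) ⊗ₜ z) =
      ((Matrix.mulVec (g.1 : Matrix (Fin a) (Fin a) ℂ) x) ⊗ₜ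
        (Matrix.mulVec (g.2.1 : Matrix (Fin b) (Fin b) ℂ) y)) ⊗ₜ
        (Matrix.mulVec (g.2.2 : Matrix (Fin c) (Fin c) ℂ) z) := rfl

theorem isPrehomogeneous_tensorRep_comm {a b c : ℕ} (h : IsPrehomogeneous (tensorRep a b c)) :
    IsPrehomogeneous (tensorRep b a c) := by
  let e := TensorProduct.congr (TensorProduct.comm ℂ (Fin a → ℂ) (Fin b → ℂ))
    (LinearEquiv.refl ℂ (Fin c → ℂ))
  refine h.of_equiv e fun g => ⟨(g.2.1, g.1, g.2.2), fun v => ?_⟩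
  have : e.toLinearMap ∘ₗ tensorRep a b c g =
      tensorRep b a c (g.2.1, g.1, g.2.2) ∘ₗ e.toLinearMap :=
    TensorProduct.ext_threefold fun x y z => rfl
  exact LinearMap.congr_fun this v

theorem isPrehomogeneous_tensorRep_rightComm {a b c : ℕ}
    (h : IsPrehomogeneous (tensorRep a b c)) : IsPrehomogeneous (tensorRep a c b) := by
  let e := TensorProduct.rightComm ℂ (Fin a → ℂ) (Fin b → ℂ) (Fin c → ℂ)
  refine h.of_equiv e fun g => ⟨(g.1, g.2.2, g.2.1), fun v => ?_⟩
  have : e.toLinearMap ∘ₗ tensorRep a b c g =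
      tensorRep a c b (g.1, g.2.2, g.2.1) ∘ₗ e.toLinearMap :=
    TensorProduct.ext_threefold fun x y z => rfl
  exact LinearMap.congr_fun this v

end Transport

/-! ### Tensors as `ab × c` matrices -/

section MatrixModel

open scoped Kronecker

/-- The identification of `ℂ^a ⊗ ℂ^b ⊗ ℂ^c` with matrices of size `ab × c`. -/
noncomputable def tensorToMatrix (a b c : ℕ) :
    ((Fin a → ℂ) ⊗[ℂ] (Fin b → ℂ) ⊗[ℂ] (Fin c → ℂ)) ≃ₗ[ℂ] Matrix (Fin a × Fin b) (Fin c) ℂ :=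
  ((((Pi.basisFun ℂ (Fin a)).tensorProduct (Pi.basisFun ℂ (Fin b))).tensorProduct
    (Pi.basisFun ℂ (Fin c))).equivFun).trans (LinearEquiv.curry ℂ ℂ (Fin a × Fin b) (Fin c))

theorem tensorToMatrix_tmul {a b c : ℕ} (x : Fin a → ℂ) (y : Fin b → ℂ) (z : Fin c → ℂ)
    (i : Fin a × Fin b) (k : Fin c) :
    tensorToMatrix a b c ((x ⊗ₜ y) ⊗ₜ z) i k = x i.1 * y i.2 * z k := by
  change (((Pi.basisFun ℂ (Fin a)).tensorProduct (Pi.basisFun ℂ (Fin b))).tensorProduct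
    (Pi.basisFun ℂ (Fin c))).repr ((x ⊗ₜ y) ⊗ₜ z) (i, k) = _
  rw [Module.Basis.tensorProduct_repr_tmul_apply, ← Prod.mk.eta (p := i),
    Module.Basis.tensorProduct_repr_tmul_apply]
  simp only [Pi.basisFun_repr, smul_eq_mul]
  ring

theorem tensorToMatrix_tensorRep {a b c : ℕ}
    (g : Matrix.GeneralLinearGroup (Fin a) ℂ × Matrix.GeneralLinearGroup (Fin b) ℂ ×
        Matrix.GeneralLinearGroup (Fin c) ℂ)
    (v : (Fin a → ℂ) ⊗[ℂ] (Fin b → ℂ) ⊗[ℂ] (Fin c → ℂ)) :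
    tensorToMatrix a b c (tensorRep a b c g v) =
      ((g.1 : Matrix (Fin a) (Fin a) ℂ) ⊗ₖ (g.2.1 : Matrix (Fin b) (Fin b) ℂ)) *
        tensorToMatrix a b c v * (g.2.2 : Matrix (Fin c) (Fin c) ℂ).transpose := by
  have : (tensorToMatrix a b c).toLinearMap ∘ₗ tensorRep a b c g =
      (mulRightLinearMap (Fin a × Fin b) ℂ (g.2.2 : Matrix (Fin c) (Fin c) ℂ).transpose ∘ₗ
        mulLeftLinearMap (Fin c) ℂ ((g.1 : Matrix (Fin a) (Fin a) ℂ) ⊗ₖ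
          (g.2.1 : Matrix (Fin b) (Fin b) ℂ))) ∘ₗ (tensorToMatrix a b c).toLinearMap := by
    refine TensorProduct.ext_threefold fun x y z => ?_
    ext ⟨i, j⟩ k
    change tensorToMatrix a b c (tensorRep a b c g ((x ⊗ₜ y) ⊗ₜ z)) (i, j) k =
      (((g.1 : Matrix (Fin a) (Fin a) ℂ) ⊗ₖ (g.2.1 : Matrix (Fin b) (Fin b) ℂ)) *
        tensorToMatrix a b c ((x ⊗ₜ y) ⊗ₜ z) *
          (g.2.2 : Matrix (Fin c) (Fin c) ℂ).transpose) (i, j) k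
    simp only [tensorRep_tmul, tensorToMatrix_tmul, Matrix.mul_apply, Matrix.mulVec, dotProduct,
      Matrix.kroneckerMap_apply, Matrix.transpose_apply, Fintype.sum_prod_type]
    rw [Finset.sum_mul_sum, Finset.mul_sum]
    refine Finset.sum_congr rfl fun r _ => ?_
    simp only [Finset.sum_mul]
    refine Finset.sum_congr rfl fun p _ => Finset.sum_congr rfl fun q _ => ?_
    ring
  exact LinearMap.congr_fun this v

/-- The orbit of a matrix under left multiplication by `S` and right multiplication by
invertible matrices. -/
def matrixOrbit {m n : Type*} [Fintype m] [Fintype n] [DecidableEq n] (S : Set (Matrix m m ℂ))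
    (X : Matrix m n ℂ) : Set (Matrix m n ℂ) :=
  {Z | ∃ s ∈ S, ∃ h : Matrix n n ℂ, IsUnit h ∧ Z = s * X * h}

/-- Kronecker products of invertible matrices. -/
def kroneckerGroup (a b : ℕ) : Set (Matrix (Fin a × Fin b) (Fin a × Fin b) ℂ) :=
  {s | ∃ g : Matrix (Fin a) (Fin a) ℂ, ∃ h : Matrix (Fin b) (Fin b) ℂ,
    IsUnit g ∧ IsUnit h ∧ s = g ⊗ₖ h}

theorem isPrehomogeneous_tensorRep_iff (a b c : ℕ) :
    IsPrehomogeneous (tensorRep a b c) ↔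
      ∃ X : Matrix (Fin a × Fin b) (Fin c) ℂ, IsPolyDense (matrixOrbit (kroneckerGroup a b) X) := by
  rw [isPrehomogeneous_iff]
  constructor
  · rintro ⟨v, hv⟩
    refine ⟨tensorToMatrix a b c v, hv.image_equiv (tensorToMatrix a b c) ?_⟩
    rintro _ ⟨g, rfl⟩
    refine ⟨_, ⟨g.1, g.2.1, g.1.isUnit, g.2.1.isUnit, rfl⟩, (g.2.2 : Matrix _ _ ℂ).transpose, ?_,
      tensorToMatrix_tensorRep g v⟩
    exact (Matrix.isUnit_transpose _).2 g.2.2.isUnit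
  · rintro ⟨X, hX⟩
    refine ⟨(tensorToMatrix a b c).symm X, hX.image_equiv (tensorToMatrix a b c).symm ?_⟩
    rintro _ ⟨_, ⟨_, _, ⟨g, rfl⟩, ⟨h, rfl⟩, rfl⟩, k, hk, rfl⟩
    obtain ⟨k', hk'⟩ := (Matrix.isUnit_transpose k).2 hk
    refine ⟨(g, h, k'), (LinearEquiv.eq_symm_apply _).2 ?_⟩
    rw [tensorToMatrix_tensorRep]
    simp [hk']

end MatrixModel

/-! ### Castling by orthogonal complements of column spaces -/

section Castling

open Matrix

variable {κ δ : Type*} [Fintype κ] [Fintype δ] [DecidableEq κ] [DecidableEq δ]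

/-- The orthogonal complement of the column space of `X`, given by polynomials in the entries of
`X`; it is spanned by the columns of this matrix when the top block of `X` is invertible. -/
noncomputable def columnComplement (X : Matrix (κ ⊕ δ) κ ℂ) : Matrix (κ ⊕ δ) δ ℂ :=
  fromRows (-(X.toRows₂ * X.toRows₁.adjugate)ᵀ) (X.toRows₁.det • (1 : Matrix δ δ ℂ))

theorem columnComplement_mul_entry_mem_polyFunctions (M : Matrix δ δ ℂ) (i : κ ⊕ δ) (j : δ) :
    (fun X : Matrix (κ ⊕ δ) κ ℂ => (columnComplement X * M) i j) ∈
      polyFunctions (Matrix (κ ⊕ δ) κ ℂ) := by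
  refine mul_entry_mem_polyFunctions (fun i j => ?_) (fun k l => const_mem_polyFunctions (M k l)) i j
  rcases i with i | i
  · have h := mul_entry_mem_polyFunctions
      (φ := fun X : Matrix (κ ⊕ δ) κ ℂ => X.toRows₂) (ψ := fun X => X.toRows₁.adjugate)
      (fun i j => entry_mem_polyFunctions (Sum.inr i) j)
      (adjugate_entry_mem_polyFunctions fun i j => entry_mem_polyFunctions (Sum.inl i) j) j i
    exact neg_mem h
  · have h : (fun X : Matrix (κ ⊕ δ) κ ℂ => X.toRows₁.det) ∈ polyFunctions _ :=
      det_mem_polyFunctions fun i j => entry_mem_polyFunctions (Sum.inl i) j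
    have h' := mul_mem h (const_mem_polyFunctions (V := Matrix (κ ⊕ δ) κ ℂ)
      ((1 : Matrix δ δ ℂ) i j))
    exact h'

theorem transpose_columnComplement_mul (X : Matrix (κ ⊕ δ) κ ℂ) :
    (columnComplement X)ᵀ * X = 0 := by
  conv_lhs => rw [← fromRows_toRows X]
  rw [columnComplement, toRows₁_fromRows, toRows₂_fromRows, transpose_fromRows, fromCols_mul_fromRows]
  simp [Matrix.mul_assoc, adjugate_mul]

/-- Cramer's rule without division: where the top block of `X` is invertible, a matrix orthogonal to
`X` is determined by its bottom block. -/
theorem det_smul_eq_columnComplement_mul {X : Matrix (κ ⊕ δ) κ ℂ} {Z : Matrix (κ ⊕ δ) δ ℂ}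
    (h : Zᵀ * X = 0) : X.toRows₁.det • Z = columnComplement X * Z.toRows₂ := by
  have h1 : (Z.toRows₁)ᵀ * X.toRows₁ = -((Z.toRows₂)ᵀ * X.toRows₂) := by
    rw [← fromRows_toRows X, ← fromRows_toRows Z, transpose_fromRows, fromCols_mul_fromRows] at h
    exact eq_neg_of_add_eq_zero_left h
  have h2 : X.toRows₁.det • (Z.toRows₁)ᵀ = -((Z.toRows₂)ᵀ * (X.toRows₂ * X.toRows₁.adjugate)) := by
    have := congrArg (· * X.toRows₁.adjugate) h1
    simpa [Matrix.mul_assoc, mul_adjugate] using this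
  have h3 : X.toRows₁.det • Z.toRows₁ = -(X.toRows₂ * X.toRows₁.adjugate)ᵀ * Z.toRows₂ := by
    have := congrArg transpose h2
    simpa [-transpose_mul, transpose_mul Z.toRows₂ᵀ] using this
  rw [columnComplement, fromRows_mul, ← h3]
  conv_lhs => rw [← fromRows_toRows Z]
  ext (i | i) j <;> simp

/-- If `s` moves a column space, its contragredient `s'` moves the orthogonal complement. A
polynomial vanishing on the dual orbit is pulled back along `columnComplement` and killed by density
of the orbit of `X₀`. -/
theorem exists_isPolyDense_matrixOrbit_castling {S S' : Set (Matrix (κ ⊕ δ) (κ ⊕ δ) ℂ)}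
    (hS : ∀ s ∈ S, ∃ s' ∈ S', s'ᵀ * s = 1) {X₀ : Matrix (κ ⊕ δ) κ ℂ}
    (hX₀ : IsPolyDense (matrixOrbit S X₀)) :
    ∃ Y₀ : Matrix (κ ⊕ δ) δ ℂ, IsPolyDense (matrixOrbit S' Y₀) := by
  have hdet : (fun X : Matrix (κ ⊕ δ) κ ℂ => X.toRows₁.det) ∈ polyFunctions _ :=
    det_mem_polyFunctions fun i j => entry_mem_polyFunctions (Sum.inl i) j
  -- Density provides an orbit point where `columnComplement` has full rank; moving its complement
  -- back by `s₀ᵀ` gives the base point `Y₀`, orthogonal to `X₀`.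
  obtain ⟨X₁, ⟨s₀, hs₀, h₀, hh₀, rfl⟩, hX₁⟩ : ∃ X ∈ matrixOrbit S X₀, X.toRows₁.det ≠ 0 := by
    by_contra! hcon
    have := hX₀ _ hdet hcon (fromRows 1 0)
    simp at this
  generalize hX₁def : s₀ * X₀ * h₀ = X₁ at hX₁
  obtain ⟨s₀', -, hs₀'⟩ := hS s₀ hs₀
  obtain ⟨Y₀, hY₀⟩ : ∃ Y₀, Y₀ = s₀ᵀ * columnComplement X₁ := ⟨_, rfl⟩
  have hY₀X₀ : Y₀ᵀ * X₀ = 0 := by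
    have h1 : Y₀ᵀ * X₀ * h₀ = 0 := by
      rw [← transpose_columnComplement_mul X₁, hY₀, transpose_mul, transpose_transpose,
        Matrix.mul_assoc, Matrix.mul_assoc, ← Matrix.mul_assoc s₀, hX₁def]
    obtain ⟨u, rfl⟩ := hh₀
    have h2 : Y₀ᵀ * X₀ * (u : Matrix κ κ ℂ) * (↑u⁻¹ : Matrix κ κ ℂ) = 0 := by
      rw [h1, Matrix.zero_mul]
    rwa [Matrix.mul_assoc, Units.mul_inv, Matrix.mul_one] at h2
  obtain ⟨L, hL⟩ : ∃ L : Matrix δ (κ ⊕ δ) ℂ, L * Y₀ = 1 := by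
    refine ⟨(fromCols 0 (X₁.toRows₁.det⁻¹ • 1) : Matrix δ (κ ⊕ δ) ℂ) * s₀', ?_⟩
    have h1 : s₀ᵀ * s₀' = 1 := by
      rw [← transpose_transpose s₀', ← transpose_mul, hs₀', transpose_one]
    rw [hY₀, Matrix.mul_assoc, ← Matrix.mul_assoc s₀', mul_eq_one_comm.1 h1, Matrix.one_mul,
      columnComplement, fromCols_mul_fromRows, Matrix.zero_mul, zero_add, Matrix.smul_mul,
      Matrix.one_mul, smul_smul, inv_mul_cancel₀ hX₁, one_smul]
  refine ⟨Y₀, fun f hf hfO => ?_⟩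
  have key : ∀ (M : Matrix δ δ ℂ), IsUnit M → ∀ X : Matrix (κ ⊕ δ) κ ℂ, X.toRows₁.det ≠ 0 →
      f (columnComplement X * M) = 0 := by
    intro M hM X hX
    have hg : (fun X : Matrix (κ ⊕ δ) κ ℂ => f (columnComplement X * M)) ∈ polyFunctions _ :=
      (isPolyMap_matrix (columnComplement_mul_entry_mem_polyFunctions M)).comp_mem hf
    -- The factor `det` makes the product vanish automatically where the top block is singular, so
    -- only orbit points with invertible top block need checking.
    have := hX₀ _ (mul_mem hdet hg) ?_ X
    · exact (mul_eq_zero.1 this).resolve_left hX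
    rintro _ ⟨s, hs, h, hh, rfl⟩
    set X' := s * X₀ * h with hX'
    simp only [Pi.mul_apply]
    by_cases hd : X'.toRows₁.det = 0
    · rw [hd, zero_mul]
    obtain ⟨s', hs', hss'⟩ := hS s hs
    let Z := s' * Y₀
    have hZ : Zᵀ * X' = 0 := by
      have : Zᵀ * X' = Y₀ᵀ * (s'ᵀ * s) * X₀ * h := by
        simp [Z, hX', Matrix.mul_assoc]
      rw [this, hss', Matrix.mul_one, hY₀X₀, Matrix.zero_mul]
    have hZW := det_smul_eq_columnComplement_mul hZ
    have hLZ : (L * sᵀ) * Z = 1 := by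
      have h2 : sᵀ * s' = 1 := by simpa using congrArg transpose hss'
      rw [Matrix.mul_assoc, ← Matrix.mul_assoc sᵀ, h2, Matrix.one_mul, hL]
    have hinv : ((X'.toRows₁.det)⁻¹ • (L * sᵀ * columnComplement X')) * Z.toRows₂ = 1 := by
      rw [Matrix.smul_mul, Matrix.mul_assoc, ← hZW, Matrix.mul_smul, smul_smul,
        inv_mul_cancel₀ hd, one_smul, hLZ]
    set N := (X'.toRows₁.det)⁻¹ • (L * sᵀ * columnComplement X')
    have hinv' : Z.toRows₂ * N = 1 := mul_eq_one_comm.1 hinv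
    -- Both `columnComplement X'` and `Z = s' * Y₀` span the complement of `X'`, so they differ by
    -- an invertible right factor.
    have hO : columnComplement X' * M ∈ matrixOrbit S' Y₀ := by
      refine ⟨s', hs', X'.toRows₁.det • (N * M), ?_, ?_⟩
      · have hN : IsUnit N := IsUnit.of_mul_eq_one _ hinv
        have := (hN.mul hM).smul (Units.mk0 _ hd)
        exact this
      · change _ = Z * _
        rw [Matrix.mul_smul, ← Matrix.smul_mul, hZW, Matrix.mul_assoc, ← Matrix.mul_assoc _ N,
          hinv', Matrix.one_mul]
    rw [hfO _ hO, mul_zero]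
  have hdet' : (fun Y : Matrix (κ ⊕ δ) δ ℂ => Y.toRows₂.det) ∈ polyFunctions _ :=
    det_mem_polyFunctions fun i j => entry_mem_polyFunctions (Sum.inr i) j
  refine eq_zero_of_mul_eq_zero_polyFunctions hdet' hf (fun Y hY => ?_)
    ⟨fromRows 0 1, by simp⟩
  have hD : IsUnit Y.toRows₂.det := isUnit_iff_ne_zero.2 hY
  -- Every `Y` with invertible bottom block is `columnComplement X` times that block, where `X` is
  -- this matrix with top block `1`.
  have := key Y.toRows₂ ((isUnit_iff_isUnit_det _).2 hD)
    (fromRows 1 (-(Y.toRows₁ * Y.toRows₂⁻¹)ᵀ)) (by simp)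
  convert this using 2
  simp only [columnComplement, toRows₁_fromRows, toRows₂_fromRows, adjugate_one, Matrix.mul_one,
    transpose_neg, transpose_transpose, neg_neg, det_one, one_smul, fromRows_mul, Matrix.one_mul,
    Matrix.mul_assoc, nonsing_inv_mul _ hD]
  exact (fromRows_toRows Y).symm

end Castling

/-! ### Castling invariance of prehomogeneity for triples -/

section CastlingTriples

open Matrix
open scoped Kronecker

theorem exists_transpose_mul_eq_one_of_mem_kroneckerGroup {a b : ℕ}
    {s : Matrix (Fin a × Fin b) (Fin a × Fin b) ℂ} (hs : s ∈ kroneckerGroup a b) :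
    ∃ s' ∈ kroneckerGroup a b, s'ᵀ * s = 1 := by
  obtain ⟨_, _, ⟨g, rfl⟩, ⟨h, rfl⟩, rfl⟩ := hs
  refine ⟨_, ⟨(↑g⁻¹ : Matrix _ _ ℂ)ᵀ, (↑h⁻¹ : Matrix _ _ ℂ)ᵀ, ?_, ?_, rfl⟩, ?_⟩
  · exact (isUnit_transpose _).2 (Units.isUnit _)
  · exact (isUnit_transpose _).2 (Units.isUnit _)
  · rw [← kroneckerMap_transpose, transpose_transpose, transpose_transpose, ← mul_kronecker_mul]
    simp

theorem isPrehomogeneous_tensorRep_castling {a b c d : ℕ} (h : c + d = a * b)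
    (hP : IsPrehomogeneous (tensorRep a b c)) : IsPrehomogeneous (tensorRep a b d) := by
  rw [isPrehomogeneous_tensorRep_iff] at hP ⊢
  obtain ⟨X, hX⟩ := hP
  let e : Fin a × Fin b ≃ Fin c ⊕ Fin d :=
    finProdFinEquiv.trans ((finCongr h.symm).trans finSumFinEquiv.symm)
  let S : Set (Matrix (Fin c ⊕ Fin d) (Fin c ⊕ Fin d) ℂ) := reindex e e '' kroneckerGroup a b
  have hS : ∀ s ∈ S, ∃ s' ∈ S, s'ᵀ * s = 1 := by
    rintro _ ⟨s, hs, rfl⟩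
    obtain ⟨s', hs', hss'⟩ := exists_transpose_mul_eq_one_of_mem_kroneckerGroup hs
    refine ⟨_, ⟨s', hs', rfl⟩, ?_⟩
    simp [submatrix_mul_equiv, hss']
  have hX' : IsPolyDense (matrixOrbit S (reindex e (Equiv.refl (Fin c)) X)) := by
    refine hX.image_equiv (reindexLinearEquiv ℂ ℂ e (Equiv.refl (Fin c))) ?_
    rintro _ ⟨s, hs, h, hh, rfl⟩
    refine ⟨_, ⟨s, hs, rfl⟩, h, hh, ?_⟩
    ext i j
    simp [Matrix.mul_apply]
  obtain ⟨Y, hY⟩ := exists_isPolyDense_matrixOrbit_castling hS hX'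
  refine ⟨reindex e.symm (Equiv.refl (Fin d)) Y,
    hY.image_equiv (reindexLinearEquiv ℂ ℂ e.symm (Equiv.refl (Fin d))) ?_⟩
  rintro _ ⟨_, ⟨s, hs, rfl⟩, h, hh, rfl⟩
  refine ⟨s, hs, h, hh, ?_⟩
  ext i j
  simp [Matrix.mul_apply, ← e.sum_comp]

/-- Prehomogeneity of the triple `(v 0, v 1, v 2)`. -/
def IsPrehomogeneousTriple (v : Fin 3 → ℕ) : Prop :=
  IsPrehomogeneous (tensorRep (v 0) (v 1) (v 2))

theorem IsPrehomogeneousTriple.comp_perm {v : Fin 3 → ℕ} (σ : Equiv.Perm (Fin 3))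
    (h : IsPrehomogeneousTriple v) : IsPrehomogeneousTriple (v ∘ σ) := by
  have hσ : σ ∈ Submonoid.closure
      (Set.range fun i : Fin 2 => Equiv.swap i.castSucc i.succ) := by
    rw [Equiv.Perm.mclosure_swap_castSucc_succ]
    trivial
  induction hσ using Submonoid.closure_induction generalizing v with
  | mem σ hσ =>
    obtain ⟨i, rfl⟩ := hσ
    fin_cases i
    · exact isPrehomogeneous_tensorRep_comm h
    · exact isPrehomogeneous_tensorRep_rightComm h
  | one => exact h
  | mul σ τ _ _ h1 h2 => exact h2 (h1 h)

theorem IsCastlingTransform.isPrehomogeneousTriple_iff {v w : Fin 3 → ℕ}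
    (h : IsCastlingTransform v w) : IsPrehomogeneousTriple v ↔ IsPrehomogeneousTriple w := by
  obtain ⟨σ, h1, h2⟩ := h
  have h0 : w 0 = v (σ 0) := h1 0
  have h1 : w 1 = v (σ 1) := h1 1
  have h2 : w 2 + v (σ 2) = v (σ 0) * v (σ 1) := by simpa [Fin.prod_univ_two] using h2
  have hσ : IsPrehomogeneousTriple v ↔ IsPrehomogeneousTriple (v ∘ σ) :=
    ⟨fun h => h.comp_perm σ, fun h => by simpa [Function.comp_assoc] using h.comp_perm σ⁻¹⟩
  rw [hσ, IsPrehomogeneousTriple, IsPrehomogeneousTriple, h0, h1]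
  exact ⟨isPrehomogeneous_tensorRep_castling ((add_comm _ _).trans h2),
    isPrehomogeneous_tensorRep_castling h2⟩

theorem CastlingEquiv.isPrehomogeneousTriple_iff {v w : Fin 3 → ℕ} (h : CastlingEquiv v w) :
    IsPrehomogeneousTriple v ↔ IsPrehomogeneousTriple w := by
  induction h with
  | rel _ _ h => exact h.isPrehomogeneousTriple_iff
  | refl => rfl
  | symm _ _ _ h => exact h.symm
  | trans _ _ _ _ _ h1 h2 => exact h1.trans h2

end CastlingTriples

/-! ### Pencils: no dense orbit for `k ≥ 4` -/

section Pencils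

open Matrix Topology
open scoped Kronecker

/-- The orbit of a pencil of square matrices `(A 0, A 1)` under `GL₂ × GLₖ × GLₖ`. -/
def pencilOrbit {k : ℕ} (A : Fin 2 → Matrix (Fin k) (Fin k) ℂ) :
    Set (Fin 2 → Matrix (Fin k) (Fin k) ℂ) :=
  {Z | ∃ g : Matrix (Fin 2) (Fin 2) ℂ, ∃ h l : Matrix (Fin k) (Fin k) ℂ,
    IsUnit g ∧ IsUnit h ∧ IsUnit l ∧ Z = fun i => ∑ j, g i j • (h * A j * l)}

/-- Splitting a matrix with `2k` rows into two square blocks. -/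
def blockEquiv (k : ℕ) :
    Matrix (Fin 2 × Fin k) (Fin k) ℂ ≃ₗ[ℂ] (Fin 2 → Matrix (Fin k) (Fin k) ℂ) where
  toFun X i := of fun p q => X (i, p) q
  invFun Z := of fun ip q => Z ip.1 ip.2 q
  map_add' _ _ := rfl
  map_smul' _ _ := rfl
  left_inv _ := rfl
  right_inv _ := rfl

theorem blockEquiv_kronecker_mul_mul {k : ℕ} (g : Matrix (Fin 2) (Fin 2) ℂ)
    (h l : Matrix (Fin k) (Fin k) ℂ) (X : Matrix (Fin 2 × Fin k) (Fin k) ℂ) :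
    blockEquiv k ((g ⊗ₖ h) * X * l) = fun i => ∑ j, g i j • (h * blockEquiv k X j * l) := by
  funext i
  ext p q
  change ((g ⊗ₖ h) * X * l) (i, p) q = (∑ j, g i j • (h * (of fun p q => X (j, p) q) * l)) p q
  simp only [Matrix.mul_apply, kroneckerMap_apply, Fintype.sum_prod_type, Matrix.sum_apply,
    Matrix.smul_apply, smul_eq_mul, Finset.mul_sum, Finset.sum_mul, of_apply]
  rw [Finset.sum_comm]
  simp only [mul_assoc]

theorem isPrehomogeneous_tensorRep_two_iff (k : ℕ) :
    IsPrehomogeneous (tensorRep 2 k k) ↔ ∃ A, IsPolyDense (pencilOrbit (k := k) A) := by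
  rw [isPrehomogeneous_tensorRep_iff]
  constructor
  · rintro ⟨X, hX⟩
    refine ⟨blockEquiv k X, hX.image_equiv (blockEquiv k) ?_⟩
    rintro _ ⟨_, ⟨g, h, hg, hh, rfl⟩, l, hl, rfl⟩
    exact ⟨g, h, l, hg, hh, hl, blockEquiv_kronecker_mul_mul g h l X⟩
  · rintro ⟨A, hA⟩
    refine ⟨(blockEquiv k).symm A, hA.image_equiv (blockEquiv k).symm ?_⟩
    rintro _ ⟨g, h, l, hg, hh, hl, rfl⟩
    refine ⟨_, ⟨g, h, hg, hh, rfl⟩, l, hl, (LinearEquiv.symm_apply_eq _).2 ?_⟩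
    rw [blockEquiv_kronecker_mul_mul, LinearEquiv.apply_symm_apply]

/-- The determinant of a pencil at five points. -/
noncomputable def pencilDet {k : ℕ} (Z : Fin 2 → Matrix (Fin k) (Fin k) ℂ) (t : Fin 5) : ℂ :=
  (Z 0 + ((t : ℕ) : ℂ) • Z 1).det

/-- Constant factors, with `b i = 0`, stand for roots at infinity when the degree drops below `k`.
-/
theorem exists_linear_factors (k : ℕ) (hk : 1 ≤ k) :
    ∀ q : Polynomial ℂ, q.natDegree ≤ k →
      ∃ a b : Fin k → ℂ, ∀ t, ∏ i, (a i + t * b i) = q.eval t := by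
  induction k, hk using Nat.le_induction with
  | base =>
    intro q hq
    refine ⟨fun _ => q.coeff 0, fun _ => q.coeff 1, fun t => ?_⟩
    conv_rhs => rw [Polynomial.eq_X_add_C_of_natDegree_le_one hq]
    simp
    ring
  | succ k _ ih =>
    intro q hq
    -- The zero polynomial has degree `⊥`, so it falls in the second branch, where `p` may be zero.
    by_cases h0 : q.degree = 0
    · obtain ⟨a, b, hab⟩ := ih q ((Polynomial.natDegree_eq_of_degree_eq_some h0).le.trans (Nat.zero_le k))
      exact ⟨Fin.cons 1 a, Fin.cons 0 b, fun t => by simp [Fin.prod_univ_succ, hab]⟩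
    · obtain ⟨r, hr⟩ := IsAlgClosed.exists_root q h0
      obtain ⟨p, rfl⟩ := Polynomial.dvd_iff_isRoot.2 hr
      have hp : p.natDegree ≤ k := by
        by_cases hp0 : p = 0
        · simp [hp0]
        · rw [Polynomial.natDegree_mul (Polynomial.X_sub_C_ne_zero r) hp0,
            Polynomial.natDegree_X_sub_C] at hq
          omega
      obtain ⟨a, b, hab⟩ := ih p hp
      refine ⟨Fin.cons (-r) a, Fin.cons 1 b, fun t => ?_⟩
      simp only [Fin.prod_univ_succ, Fin.cons_zero, Fin.cons_succ, hab, Polynomial.eval_mul,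
        Polynomial.eval_sub, Polynomial.eval_X, Polynomial.eval_C]
      ring

/-- Five values are interpolated in degree at most `4 ≤ k`, and a diagonal pencil realizes any
product of `k` affine factors. -/
theorem pencilDet_surjective {k : ℕ} (hk : 4 ≤ k) :
    Function.Surjective (pencilDet (k := k)) := by
  intro v
  have hinj : Set.InjOn (fun t : Fin 5 => ((t : ℕ) : ℂ)) (Finset.univ : Finset (Fin 5)) :=
    fun x _ y _ h => Fin.ext (Nat.cast_injective h)
  let q := Lagrange.interpolate Finset.univ (fun t : Fin 5 => ((t : ℕ) : ℂ)) v
  have hq : q.natDegree ≤ k := by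
    refine le_trans (Polynomial.natDegree_le_of_degree_le
      (Lagrange.degree_interpolate_le v hinj)) ?_
    simpa using hk
  obtain ⟨a, b, hab⟩ := exists_linear_factors k (by omega) q hq
  refine ⟨![diagonal a, diagonal b], funext fun t => ?_⟩
  have : ![diagonal a, diagonal b] 0 + ((t : ℕ) : ℂ) • ![diagonal a, diagonal b] 1 =
      diagonal fun i => a i + ((t : ℕ) : ℂ) * b i := by
    ext i j
    by_cases hij : i = j
    · subst hij
      simp
    · simp [hij]
  rw [pencilDet, this, det_diagonal, hab]
  exact Lagrange.eval_interpolate_at_node v hinj (Finset.mem_univ t)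

/-- The value `det ((x₀₀ + t x₁₀) A₀ + (x₀₁ + t x₁₁) A₁)` as a polynomial in the `xᵢⱼ`. -/
noncomputable def pencilDetPolynomial {k : ℕ} (A : Fin 2 → Matrix (Fin k) (Fin k) ℂ) (t : Fin 5) :
    MvPolynomial (Fin 2 × Fin 2) ℂ :=
  (of fun p q => ∑ j, (MvPolynomial.X (0, j) + MvPolynomial.C ((t : ℕ) : ℂ) * MvPolynomial.X (1, j)) *
    MvPolynomial.C (A j p q)).det

theorem eval_pencilDetPolynomial {k : ℕ} (A : Fin 2 → Matrix (Fin k) (Fin k) ℂ) (t : Fin 5)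
    (x : Fin 2 × Fin 2 → ℂ) :
    MvPolynomial.eval x (pencilDetPolynomial A t) =
      (∑ j, (x (0, j) + ((t : ℕ) : ℂ) * x (1, j)) • A j).det := by
  rw [pencilDetPolynomial, RingHom.map_det]
  congr 1
  ext p q
  simp [Matrix.sum_apply]

theorem exists_pencilDet_eq_eval {k : ℕ} (hk : k ≠ 0) {A Z : Fin 2 → Matrix (Fin k) (Fin k) ℂ}
    (hZ : Z ∈ pencilOrbit A) :
    ∃ x : Fin 2 × Fin 2 → ℂ, ∀ t, pencilDet Z t = MvPolynomial.eval x (pencilDetPolynomial A t) := by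
  obtain ⟨g, h, l, -, -, -, rfl⟩ := hZ
  -- The determinant is homogeneous of degree `k`, so a `k`-th root of `det h * det l` can be
  -- absorbed into `g`; only its four entries remain as parameters.
  obtain ⟨c, hc⟩ := IsAlgClosed.exists_pow_nat_eq (h.det * l.det) (Nat.pos_of_ne_zero hk)
  refine ⟨fun i => c * g i.1 i.2, fun t => ?_⟩
  rw [eval_pencilDetPolynomial, pencilDet]
  have h1 : (∑ j, g 0 j • (h * A j * l)) + ((t : ℕ) : ℂ) • (∑ j, g 1 j • (h * A j * l)) =
      h * (∑ j, (g 0 j + ((t : ℕ) : ℂ) * g 1 j) • A j) * l := by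
    simp only [Fin.sum_univ_two, Matrix.mul_add, Matrix.add_mul, Matrix.mul_smul, Matrix.smul_mul]
    module
  have h2 : ∑ j, (c * g 0 j + ((t : ℕ) : ℂ) * (c * g 1 j)) • A j =
      c • ∑ j, (g 0 j + ((t : ℕ) : ℂ) * g 1 j) • A j := by
    simp only [Fin.sum_univ_two]
    module
  rw [h1, h2, det_smul, det_mul, det_mul, Fintype.card_fin, hc]
  ring

/-- Five polynomials in four variables exceed the transcendence degree. -/
theorem exists_relation_pencilDetPolynomial {k : ℕ} (A : Fin 2 → Matrix (Fin k) (Fin k) ℂ) :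
    ∃ P : MvPolynomial (Fin 5) ℂ, P ≠ 0 ∧ MvPolynomial.aeval (pencilDetPolynomial A) P = 0 := by
  have h : ¬ AlgebraicIndependent ℂ (pencilDetPolynomial A) := by
    intro h
    have := h.lift_cardinalMk_le_trdeg
    rw [MvPolynomial.trdeg_of_isDomain] at this
    simp at this
    norm_cast at this
  rw [algebraicIndependent_iff] at h
  push Not at h
  obtain ⟨P, h1, h2⟩ := h
  exact ⟨P, h2, h1⟩

theorem eval_mem_polyFunctions {V ι : Type*} [AddCommMonoid V] [Module ℂ V] {φ : V → ι → ℂ}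
    (h : ∀ i, (fun v => φ v i) ∈ polyFunctions V) (P : MvPolynomial ι ℂ) :
    (fun v => MvPolynomial.eval (φ v) P) ∈ polyFunctions V := by
  induction P using MvPolynomial.induction_on with
  | C a => simpa using const_mem_polyFunctions a
  | add p q hp hq =>
    simp only [map_add]
    exact add_mem hp hq
  | mul_X p i hp =>
    simp only [map_mul, MvPolynomial.eval_X]
    exact mul_mem hp (h i)

theorem not_isPolyDense_pencilOrbit {k : ℕ} (hk : 4 ≤ k) (A : Fin 2 → Matrix (Fin k) (Fin k) ℂ) :
    ¬ IsPolyDense (pencilOrbit A) := by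
  intro hA
  obtain ⟨P, hP0, hP⟩ := exists_relation_pencilDetPolynomial A
  have hmem : ∀ t, (fun Z : Fin 2 → Matrix (Fin k) (Fin k) ℂ => pencilDet Z t) ∈
      polyFunctions (Fin 2 → Matrix (Fin k) (Fin k) ℂ) := by
    intro t
    refine det_mem_polyFunctions fun i j => ?_
    have h : ∀ r : Fin 2, (fun Z : Fin 2 → Matrix (Fin k) (Fin k) ℂ => Z r i j) ∈
        polyFunctions (Fin 2 → Matrix (Fin k) (Fin k) ℂ) := fun r =>
      dual_mem_polyFunctions (Matrix.entryLinearMap ℂ ℂ i j ∘ₗ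
        (LinearMap.proj r : (Fin 2 → Matrix (Fin k) (Fin k) ℂ) →ₗ[ℂ] _))
    exact add_mem (h 0) (Subalgebra.smul_mem _ (h 1) ((t : ℕ) : ℂ))
  have hf := eval_mem_polyFunctions hmem P
  apply hP0
  apply MvPolynomial.funext
  intro v
  obtain ⟨Z, rfl⟩ := pencilDet_surjective hk v
  rw [map_zero]
  refine hA _ hf (fun Z hZ => ?_) Z
  obtain ⟨x, hx⟩ := exists_pencilDet_eq_eval (by omega) hZ
  have h1 : pencilDet Z = fun t => MvPolynomial.eval x (pencilDetPolynomial A t) := funext hx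
  have h2 := congrArg (MvPolynomial.eval x) hP
  rw [h1]
  rwa [map_zero, ← MvPolynomial.aeval_eq_eval, MvPolynomial.comp_aeval_apply,
    MvPolynomial.aeval_eq_eval, MvPolynomial.aeval_eq_eval] at h2

end Pencils

/-! ### Pencils: an open orbit for `k ≤ 3` -/

section OpenOrbit

open Topology

variable {R : Type*} [NormedRing R] [NormedAlgebra ℂ R]

/-- The orbit map of the action of `GL₂ × Rˣ × Rˣ` on pairs of elements of `R`. -/
def pencilMap (A : Fin 2 → R) (x : (Fin 2 → Fin 2 → ℂ) × R × R) : Fin 2 → R :=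
  fun i => ∑ j, x.1 i j • (x.2.1 * A j * x.2.2)

theorem contDiff_pencilMap (A : Fin 2 → R) : ContDiff ℂ 1 (pencilMap A) := by
  unfold pencilMap
  fun_prop

theorem hasDerivAt_pencilMap (A : Fin 2 → R) (p : Fin 2 → Fin 2 → ℂ) (X Y : R) :
    HasDerivAt (fun t : ℂ => pencilMap A
      (((fun i j => if i = j then 1 else 0), 1, 1) + t • (p, X, Y)))
      (fun i => X * A i + A i * Y + ∑ j, p i j • A j) 0 := by
  rw [hasDerivAt_pi]
  intro i
  have hX : ∀ X : R, HasDerivAt (fun t : ℂ => 1 + t • X) X 0 := fun X => by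
    simpa using ((hasDerivAt_id (0 : ℂ)).smul_const X).const_add 1
  have hp : ∀ j, HasDerivAt (fun t : ℂ => (if i = j then 1 else 0) + t * p i j)
      (p i j) 0 := fun j => by
    simpa using ((hasDerivAt_id (0 : ℂ)).mul_const (p i j)).const_add (if i = j then 1 else 0)
  have h := HasDerivAt.fun_sum (u := Finset.univ) fun j _ =>
    (hp j).fun_smul (((hX X).mul_const (A j)).fun_mul (hX Y))
  refine h.congr_deriv ?_
  simp [Finset.sum_add_distrib]

/-- By hypothesis the derivative of the orbit map at the identity is onto, so neighbourhoods of the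
identity map onto neighbourhoods of `A`. Invertibility is an open condition, hence `f` vanishes near
`A`, and therefore everywhere. -/
theorem eq_zero_of_pencilMap_eq_zero [CompleteSpace R] (A : Fin 2 → R)
    (h : ∀ W : Fin 2 → R, ∃ (p : Fin 2 → Fin 2 → ℂ) (X Y : R),
      (fun i => X * A i + A i * Y + ∑ j, p i j • A j) = W)
    {f : (Fin 2 → R) → ℂ} (hf : f ∈ polyFunctions (Fin 2 → R))
    (hf0 : ∀ x : (Fin 2 → Fin 2 → ℂ) × R × R, x.1 0 0 * x.1 1 1 - x.1 0 1 * x.1 1 0 ≠ 0 →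
      IsUnit x.2.1 → IsUnit x.2.2 → f (pencilMap A x) = 0) (Z : Fin 2 → R) : f Z = 0 := by
  let u₀ : (Fin 2 → Fin 2 → ℂ) × R × R := ((fun i j => if i = j then 1 else 0), 1, 1)
  have hd : HasStrictFDerivAt (pencilMap A) (fderiv ℂ (pencilMap A) u₀) u₀ :=
    (contDiff_pencilMap A).contDiffAt.hasStrictFDerivAt one_ne_zero
  have hsurj : (fderiv ℂ (pencilMap A) u₀).range = ⊤ := by
    rw [LinearMap.range_eq_top]
    intro W
    obtain ⟨p, X, Y, rfl⟩ := h W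
    refine ⟨(p, X, Y), ?_⟩
    have h1 : HasDerivAt (fun t : ℂ => u₀ + t • (p, X, Y)) (p, X, Y) 0 := by
      have := ((hasDerivAt_id (0 : ℂ)).smul_const (p, X, Y)).const_add u₀
      rwa [one_smul] at this
    have h2 : HasFDerivAt (pencilMap A) (fderiv ℂ (pencilMap A) u₀)
        (u₀ + (0 : ℂ) • (p, X, Y)) := by
      rw [zero_smul, add_zero]
      exact hd.hasFDerivAt
    have h3 := h2.comp_hasDerivAt (0 : ℂ) h1
    exact h3.unique (hasDerivAt_pencilMap A p X Y)
  have hmap := hd.map_nhds_eq_of_surj hsurj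
  have hU : ∀ᶠ x in 𝓝 u₀, f (pencilMap A x) = 0 := by
    have h1 : ∀ᶠ x in 𝓝 u₀, x.1 0 0 * x.1 1 1 - x.1 0 1 * x.1 1 0 ≠ 0 :=
      (isOpen_ne_fun (by fun_prop) continuous_const).mem_nhds (by simp [u₀])
    have h2 : ∀ᶠ x in 𝓝 u₀, IsUnit x.2.1 :=
      (Units.isOpen.preimage (continuous_fst.comp continuous_snd)).mem_nhds (by simp [u₀])
    have h3 : ∀ᶠ x in 𝓝 u₀, IsUnit x.2.2 :=
      (Units.isOpen.preimage (continuous_snd.comp continuous_snd)).mem_nhds (by simp [u₀])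
    filter_upwards [h1, h2, h3] with x hx1 hx2 hx3 using hf0 x hx1 hx2 hx3
  have hO : ∀ᶠ Z in 𝓝 (pencilMap A u₀), f Z = 0 := by
    rw [← hmap]
    exact hU
  refine eq_zero_of_eventually_line hf (pencilMap A u₀) (fun w => ?_) Z
  have hc : Filter.Tendsto (fun t : ℂ => pencilMap A u₀ + t • w) (𝓝 0) (𝓝 (pencilMap A u₀)) := by
    have : Continuous (fun t : ℂ => pencilMap A u₀ + t • w) := by fun_prop
    simpa using this.tendsto 0
  exact hc.eventually hO

open Matrix

theorem isPolyDense_pencilOrbit_of_surjective {k : ℕ} (A : Fin 2 → Matrix (Fin k) (Fin k) ℂ)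
    (h : ∀ W : Fin 2 → Matrix (Fin k) (Fin k) ℂ, ∃ (p : Fin 2 → Fin 2 → ℂ)
      (X Y : Matrix (Fin k) (Fin k) ℂ), (fun i => X * A i + A i * Y + ∑ j, p i j • A j) = W) :
    IsPolyDense (pencilOrbit A) := by
  intro f hf hfO
  let _ : NormedRing (Matrix (Fin k) (Fin k) ℂ) := Matrix.linftyOpNormedRing
  let _ : NormedAlgebra ℂ (Matrix (Fin k) (Fin k) ℂ) := Matrix.linftyOpNormedAlgebra
  have : CompleteSpace (Matrix (Fin k) (Fin k) ℂ) := FiniteDimensional.complete ℂ _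
  refine eq_zero_of_pencilMap_eq_zero A h hf fun x h1 h2 h3 =>
    hfO _ ⟨of x.1, x.2.1, x.2.2, ?_, h2, h3, rfl⟩
  rw [isUnit_iff_isUnit_det, isUnit_iff_ne_zero, det_fin_two]
  exact h1

/-- This is where `k ≤ 3` enters: three coefficients must match `k` diagonal entries. -/
theorem exists_quadratic_interpolation {k : ℕ} (hk : k ≤ 3) (w : Fin k → ℂ) :
    ∃ a b c : ℂ, ∀ i : Fin k, a + b * ((i : ℕ) : ℂ) + c * ((i : ℕ) : ℂ) ^ 2 = w i := by
  have hinj : Set.InjOn (fun t : Fin k => ((t : ℕ) : ℂ)) (Finset.univ : Finset (Fin k)) :=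
    fun x _ y _ h => Fin.ext (Nat.cast_injective h)
  let q := Lagrange.interpolate Finset.univ (fun t : Fin k => ((t : ℕ) : ℂ)) w
  have hq : q.degree < (3 : ℕ) := by
    refine (Lagrange.degree_interpolate_lt w hinj).trans_le ?_
    simpa using hk
  refine ⟨q.coeff 0, q.coeff 1, q.coeff 2, fun i => ?_⟩
  have h1 : q.eval ((i : ℕ) : ℂ) = w i :=
    Lagrange.eval_interpolate_at_node w hinj (Finset.mem_univ i)
  have h2 : q.natDegree < 3 := by
    by_cases h0 : q = 0
    · simp [h0]
    · exact (Polynomial.natDegree_lt_iff_degree_lt h0).2 hq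
  rw [Polynomial.eval_eq_sum_range' h2] at h1
  simpa [Finset.sum_range_succ] using h1

theorem exists_isPolyDense_pencilOrbit {k : ℕ} (hk : k ≤ 3) :
    ∃ A : Fin 2 → Matrix (Fin k) (Fin k) ℂ, IsPolyDense (pencilOrbit A) := by
  let D : Matrix (Fin k) (Fin k) ℂ := diagonal fun i => ((i : ℕ) : ℂ)
  refine ⟨![1, D], isPolyDense_pencilOrbit_of_surjective _ fun W => ?_⟩
  obtain ⟨a, b, c, habc⟩ := exists_quadratic_interpolation hk
    fun i => W 1 i i - ((i : ℕ) : ℂ) * W 0 i i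
  -- Eliminating `Y` leaves `XD - DX + a + bD + cD² = W₁ - DW₀`. The commutator solves the
  -- off-diagonal entries and the quadratic the diagonal ones; the diagonal of `X` (here `0` by
  -- division by zero) cancels.
  let X : Matrix (Fin k) (Fin k) ℂ := of fun i j =>
    (W 1 i j - ((i : ℕ) : ℂ) * W 0 i j) / (((j : ℕ) : ℂ) - ((i : ℕ) : ℂ))
  refine ⟨![![0, -c], ![a, b]], X, W 0 - X + c • D, ?_⟩
  funext r
  fin_cases r
  · simp [Fin.sum_univ_two]
    abel
  · ext i j
    simp only [Fin.sum_univ_two, Fin.mk_one, Matrix.cons_val_one, Matrix.cons_val_zero,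
      Matrix.add_apply, Matrix.smul_apply, Matrix.one_apply, D, Matrix.mul_diagonal,
      Matrix.diagonal_mul, Matrix.sub_apply, diagonal_apply, X, of_apply, smul_eq_mul]
    by_cases hij : i = j
    · subst hij
      have := habc i
      simp
      linear_combination this
    · have h1 : ((j : ℕ) : ℂ) - ((i : ℕ) : ℂ) ≠ 0 := by
        rw [sub_ne_zero]
        exact fun h => hij (Fin.ext (Nat.cast_injective h)).symm
      simp only [hij, if_false]
      field_simp
      ring

theorem isPrehomogeneousTriple_two_iff (k : ℕ) :
    IsPrehomogeneousTriple ![2, k, k] ↔ k ≤ 3 := by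
  refine (isPrehomogeneous_tensorRep_two_iff k).trans
    ⟨fun ⟨A, hA⟩ => ?_, exists_isPolyDense_pencilOrbit⟩
  by_contra hk
  exact not_isPolyDense_pencilOrbit (by omega) A hA

end OpenOrbit

/-! ### Arithmetic of triples with `N = 2`: invariant and descent -/

section Triples

theorem tensorN_comp_perm {n : ℕ} (v : Fin n → ℕ) (σ : Equiv.Perm (Fin n)) :
    tensorN (v ∘ σ) = tensorN v := by
  unfold tensorN
  simp only [Function.comp_apply]
  rw [Equiv.sum_comp σ fun i => (v i : ℤ) ^ 2 - 1, Equiv.prod_comp σ fun i => (v i : ℤ)]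

theorem tensorN_three (v : Fin 3 → ℕ) :
    tensorN v = (v 0 : ℤ) ^ 2 + (v 1 : ℤ) ^ 2 + (v 2 : ℤ) ^ 2 - v 0 * v 1 * v 2 - 2 := by
  simp only [tensorN, Fin.sum_univ_three, Fin.prod_univ_three]
  ring

theorem IsCastlingTransform.exists_perm_three {v w : Fin 3 → ℕ} (h : IsCastlingTransform v w) :
    ∃ σ : Equiv.Perm (Fin 3), w 0 = v (σ 0) ∧ w 1 = v (σ 1) ∧
      w 2 + v (σ 2) = v (σ 0) * v (σ 1) := by
  obtain ⟨σ, h1, h2⟩ := h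
  exact ⟨σ, h1 0, h1 1, by simpa [Fin.prod_univ_two] using h2⟩

theorem isCastlingTransform_three {v w : Fin 3 → ℕ} (σ : Equiv.Perm (Fin 3)) (h0 : w 0 = v (σ 0))
    (h1 : w 1 = v (σ 1)) (h2 : w 2 + v (σ 2) = v (σ 0) * v (σ 1)) : IsCastlingTransform v w := by
  refine ⟨σ, fun i => ?_, by simpa [Fin.prod_univ_two] using h2⟩
  fin_cases i
  · exact h0
  · exact h1

/-- Triples with `N = 2` such that `g` divides `aᵢ² - 4` for each entry `aᵢ`. -/
def TripleDvd (g : ℤ) (v : Fin 3 → ℕ) : Prop :=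
  tensorN v = 2 ∧ ∀ i, g ∣ (v i : ℤ) ^ 2 - 4

theorem tripleDvd_comp_perm (g : ℤ) (v : Fin 3 → ℕ) (σ : Equiv.Perm (Fin 3)) :
    TripleDvd g (v ∘ σ) ↔ TripleDvd g v := by
  rw [TripleDvd, TripleDvd, tensorN_comp_perm]
  exact and_congr_right fun _ => σ.forall_congr_right (q := fun i => g ∣ (v i : ℤ) ^ 2 - 4)

/-- For `N = 2` one has `(ab - 2c)² = (a² - 4)(b² - 4)`, so `g²` divides the square and `g ∣ ab -
2c`; this is what `c² - 4` changes by, up to the factor `ab`. -/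
theorem TripleDvd.castling {g : ℤ} {v w : Fin 3 → ℕ} (hv : TripleDvd g v) (h0 : w 0 = v 0)
    (h1 : w 1 = v 1) (h2 : w 2 + v 2 = v 0 * v 1) : TripleDvd g w := by
  obtain ⟨hN, hd⟩ := hv
  have h2' : (w 2 : ℤ) = v 0 * v 1 - v 2 := by
    have : (w 2 : ℤ) + v 2 = v 0 * v 1 := by exact_mod_cast h2
    linarith
  rw [tensorN_three] at hN
  refine ⟨?_, fun i => ?_⟩
  · rw [tensorN_three, h0, h1, h2']
    linear_combination hN
  · fin_cases i
    · simpa [h0] using hd 0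
    · simpa [h1] using hd 1
    · have hsq : g ^ 2 ∣ ((v 0 : ℤ) * v 1 - 2 * v 2) ^ 2 := by
        have h3 : ((v 0 : ℤ) * v 1 - 2 * v 2) ^ 2 = ((v 0 : ℤ) ^ 2 - 4) * ((v 1 : ℤ) ^ 2 - 4) := by
          linear_combination 4 * hN
        rw [h3, sq]
        exact mul_dvd_mul (hd 0) (hd 1)
      have hdvd : g ∣ (v 0 : ℤ) * v 1 - 2 * v 2 := (Int.pow_dvd_pow_iff two_ne_zero).1 hsq
      have h4 : ((w 2 : ℕ) : ℤ) ^ 2 - 4 =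
          ((v 2 : ℤ) ^ 2 - 4) + (v 0 * v 1) * ((v 0 : ℤ) * v 1 - 2 * v 2) := by
        rw [h2']
        ring
      change g ∣ ((w 2 : ℕ) : ℤ) ^ 2 - 4
      rw [h4]
      exact dvd_add (hd 2) (hdvd.mul_left _)

theorem IsCastlingTransform.tripleDvd_iff {g : ℤ} {v w : Fin 3 → ℕ}
    (h : IsCastlingTransform v w) : TripleDvd g v ↔ TripleDvd g w := by
  obtain ⟨σ, h0, h1, h2⟩ := h.exists_perm_three
  rw [← tripleDvd_comp_perm g v σ]
  exact ⟨fun hv => hv.castling h0 h1 h2, fun hw => hw.castling h0.symm h1.symm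
    (by rw [h0, h1, ← h2, add_comm]; rfl)⟩

theorem CastlingEquiv.tripleDvd_iff {g : ℤ} {v w : Fin 3 → ℕ} (h : CastlingEquiv v w) :
    TripleDvd g v ↔ TripleDvd g w := by
  induction h with
  | rel _ _ h => exact h.tripleDvd_iff
  | refl => rfl
  | symm _ _ _ h => exact h.symm
  | trans _ _ _ _ _ h1 h2 => exact h1.trans h2

theorem tripleDvd_two_iff (g : ℤ) (k : ℕ) : TripleDvd g ![2, k, k] ↔ g ∣ (k : ℤ) ^ 2 - 4 := by
  constructor
  · intro h
    exact h.2 1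
  · intro h
    refine ⟨?_, fun i => ?_⟩
    · rw [tensorN_three]
      simp only [Matrix.cons_val_zero, Matrix.cons_val_one, Matrix.cons_val]
      push_cast
      ring
    · fin_cases i
      exacts [⟨0, by norm_num⟩, h, h]

theorem eq_of_castlingEquiv_two {k l : ℕ} (hk : 0 < k) (hl : 0 < l)
    (h : CastlingEquiv ![2, k, k] ![2, l, l]) : k = l := by
  have h1 : (k : ℤ) ^ 2 - 4 ∣ (l : ℤ) ^ 2 - 4 :=
    (tripleDvd_two_iff _ l).1 (h.tripleDvd_iff.1 ((tripleDvd_two_iff _ k).2 dvd_rfl))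
  have h2 : (l : ℤ) ^ 2 - 4 ∣ (k : ℤ) ^ 2 - 4 :=
    (tripleDvd_two_iff _ k).1 (h.tripleDvd_iff.2 ((tripleDvd_two_iff _ l).2 dvd_rfl))
  rcases Int.natAbs_eq_natAbs_iff.1 (Int.natAbs_eq_of_dvd_dvd h1 h2) with h3 | h3
  · have : k ^ 2 = l ^ 2 := by
      zify
      linarith
    exact Nat.pow_left_injective two_ne_zero this
  -- Opposite signs leave only `k = l = 2`.
  · have h4 : k ^ 2 + l ^ 2 = 8 := by
      zify
      linarith
    have hk3 : k < 3 := by nlinarith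
    have hl3 : l < 3 := by nlinarith
    interval_cases k <;> interval_cases l <;> simp_all

theorem exists_castlingEquiv_two (n : ℕ) : ∀ v : Fin 3 → ℕ, (∑ i, v i) = n → (∀ i, 0 < v i) →
    tensorN v = 2 → ∃ k, 0 < k ∧ CastlingEquiv v ![2, k, k] := by
  induction n using Nat.strong_induction_on with
  | _ n ih =>
  intro v hn hpos hN
  let σ := Tuple.sort v
  have hmono : Monotone (v ∘ σ) := Tuple.monotone_sort v
  have hab : v (σ 0) ≤ v (σ 1) := hmono (by decide)
  have hbc : v (σ 1) ≤ v (σ 2) := hmono (by decide)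
  have ha := hpos (σ 0)
  have hsum : v (σ 0) + v (σ 1) + v (σ 2) = n := by
    rw [← hn, ← Equiv.sum_comp σ, Fin.sum_univ_three]
  rw [← tensorN_comp_perm v σ, tensorN_three] at hN
  simp only [Function.comp_apply] at hN
  obtain ⟨a, haσ⟩ : ∃ a, a = v (σ 0) := ⟨_, rfl⟩
  obtain ⟨b, hbσ⟩ : ∃ b, b = v (σ 1) := ⟨_, rfl⟩
  obtain ⟨c, hcσ⟩ : ∃ c, c = v (σ 2) := ⟨_, rfl⟩
  rw [← haσ, ← hbσ] at hab
  rw [← hbσ, ← hcσ] at hbc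
  rw [← haσ] at ha
  rw [← haσ, ← hbσ, ← hcσ] at hN hsum
  have habZ : (a : ℤ) ≤ b := by exact_mod_cast hab
  have hbcZ : (b : ℤ) ≤ c := by exact_mod_cast hbc
  have haZ : (1 : ℤ) ≤ a := by exact_mod_cast ha
  rcases (by omega : a = 1 ∨ a = 2 ∨ 3 ≤ a) with h | h | h
  · subst h
    have hb1 : b = 1 := by
      have : (b : ℤ) < 2 := by
        push_cast at hN
        nlinarith
      omega
    subst hb1
    have hc2 : c = 2 := by
      have h1 : ((c : ℤ) - 2) * (c + 1) = 0 := by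
        push_cast at hN
        linear_combination hN
      rcases mul_eq_zero.1 h1 with h1 | h1 <;> omega
    subst hc2
    refine ⟨1, one_pos, .rel _ _ (isCastlingTransform_three (σ * Equiv.swap 0 2) ?_ ?_ ?_)⟩
    · simpa using hcσ
    · simpa [Equiv.swap_apply_of_ne_of_ne] using hbσ
    · simp [Equiv.swap_apply_of_ne_of_ne, ← haσ, ← hbσ, ← hcσ]
  · subst h
    have hbc' : b = c := by
      have h1 : ((b : ℤ) - c) ^ 2 = 0 := by
        push_cast at hN
        linear_combination hN
      have := pow_eq_zero_iff two_ne_zero |>.1 h1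
      omega
    subst hbc'
    -- As `2b - b = b`, this castling step only permutes the entries.
    refine ⟨b, by omega, .rel _ _ (isCastlingTransform_three σ ?_ ?_ ?_)⟩
    · simpa using haσ
    · simpa using hbσ
    · simp [← haσ, ← hbσ, ← hcσ]
      ring
  · have hZ : (3 : ℤ) ≤ a := by exact_mod_cast h
    have hprod : (c : ℤ) * (a * b - c) = a ^ 2 + b ^ 2 - 4 := by linear_combination -hN
    have hlt : c < a * b := by
      zify
      by_contra! hcon
      nlinarith
    have hdesc : a * b < 2 * c := by
      zify
      by_contra! hcon
      -- The numbers `c` and `ab - c` are the roots of `t² - abt + a² + b² - 4`; its value at `t =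
      -- b` is negative, so `b` lies strictly between them.
      have h1 : ((b : ℤ) - c) * (b - (a * b - c)) = (2 - a) * (b ^ 2 - a - 2) := by
        linear_combination hprod
      have h2 : 0 ≤ ((b : ℤ) - c) * (b - (a * b - c)) :=
        mul_nonneg_of_nonpos_of_nonpos (by linarith) (by linarith)
      have h3 : (0 : ℤ) < b ^ 2 - a - 2 := by nlinarith
      nlinarith
    have hcast : IsCastlingTransform v ![a, b, a * b - c] := by
      refine isCastlingTransform_three σ ?_ ?_ ?_
      · simpa using haσ
      · simpa using hbσ
      · simp [← haσ, ← hbσ, ← hcσ]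
        omega
    obtain ⟨k, hk, hk'⟩ := ih (a + b + (a * b - c)) (by omega) ![a, b, a * b - c]
      (by simp [Fin.sum_univ_three]) (by
        intro i
        fin_cases i
        · exact ha
        · exact ha.trans_le hab
        · exact Nat.sub_pos_of_lt hlt) (by
        rw [tensorN_three]
        simp only [Matrix.cons_val_zero, Matrix.cons_val_one, Matrix.cons_val]
        push_cast [hlt.le]
        linear_combination hN)
    exact ⟨k, hk, .trans _ _ _ (.rel _ _ hcast) hk'⟩

end Triples

theorem mainTheorem3 (a b c : ℕ) (ha : 0 < a) (hb : 0 < b) (hc : 0 < c)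
    (hN : tensorN ![a, b, c] = 2) :
    (∃! k : ℕ, 0 < k ∧ CastlingEquiv ![a, b, c] ![2, k, k]) ∧
      ∀ k : ℕ, 0 < k → CastlingEquiv ![a, b, c] ![2, k, k] →
        (IsPrehomogeneous (tensorRep a b c) ↔ k ≤ 3) := by
  refine ⟨?_, fun k _ h => ?_⟩
  · obtain ⟨k, hk, hk'⟩ := exists_castlingEquiv_two _ ![a, b, c] rfl (by
      intro i
      fin_cases i
      exacts [ha, hb, hc]) hN
    exact ⟨k, ⟨hk, hk'⟩, fun l ⟨hl, hl'⟩ =>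
      eq_of_castlingEquiv_two hl hk (.trans _ _ _ (.symm _ _ hl') hk')⟩
  · exact h.isPrehomogeneousTriple_iff.trans (isPrehomogeneousTriple_two_iff k)
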